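/- Fix a universe of small sets. Let $\kappa$ and $\lambda$ be regular (infinite) cardinals such that either $\kappa = \lambda$ or $\kappa \vartriangleleft \lambda$, where $\kappa \vartriangleleft \lambda$ ("$\kappa$ is sharply less than $\lambda$") means that $\kappa < \lambda$ and, for every set $X$ of cardinality $< \lambda$, the set of subsets of $X$ of cardinality $< \kappa$, partially ordered by inclusion, has a cofinal subset of cardinality $< \lambda$. Let $\mathcal{C}$ be a locally small category in which all idempotent endomorphisms split. Then the following are equivalent: (i) $\mathcal{C}$ is $(\kappa,\lambda)$-accessibly generated; (ii) $\mathbf{Ind}_\lambda(\mathcal{C})$ is a $\kappa$-accessible category; (iii) $\mathcal{C}$ is equivalent to $\mathbf{K}_\lambda(\mathcal{D})$ for some $\kappa$-accessible category $\mathcal{D}$. Here a category is called $\lambda$-small if it has fewer than $\lambda$ morphisms, and $\kappa$-filtered if every diagram in it indexed by a $\kappa$-small category admits a cocone; a diagram is called small, $\lambda$-small or $\kappa$-filtered if its indexing category is. An object $A$ of a locally small category is $\kappa$-presentable (respectively $(\kappa,\lambda)$-presentable) if $\mathrm{Hom}(A,-)$ preserves colimits of all small (respectively all $\lambda$-small)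 $\kappa$-filtered diagrams. A category $\mathcal{C}$ is $(\kappa,\lambda)$-accessibly generated if it is essentially small, every $\lambda$-small $\kappa$-filtered diagram in $\mathcal{C}$ has a colimit in $\mathcal{C}$, and every object of $\mathcal{C}$ is a colimit of some $\lambda$-small $\kappa$-filtered diagram of $(\kappa,\lambda)$-presentable objects of $\mathcal{C}$. A locally small category is $\kappa$-accessible if it has colimits of all small $\kappa$-filtered diagrams and there is a small set $\mathcal{G}$ of $\kappa$-presentable objects such that every object is the colimit of some small $\kappa$-filtered diagram with vertices in $\mathcal{G}$. $\mathbf{K}_\lambda(\mathcal{D})$ is the full subcategory of $\lambda$-presentable objects of $\mathcal{D}$. $\mathbf{Ind}_\lambda(\mathcal{C})$ is the free $\lambda$-ind-completion, i.e. the full subcategory of the category of presheaves of sets on $\mathcal{C}$ spanned by the colimits of small $\lambda$-filtered diagrams of representable presheaves. -/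

import Mathlib

open CategoryTheory Limits Opposite

universe w v u

namespace AccGen

/-- The relation `κ ◁ lam` ("`κ` is sharply less than `lam`") between regular cardinals:
`κ < lam` and, for every `lam`-small set `X`, the set of `κ`-small subsets of `X`, ordered by
inclusion, has a `lam`-small cofinal subset. -/
def IsSharplyLess (κ lam : Cardinal.{w}) : Prop :=
  κ < lam ∧ ∀ X : Type w, HasCardinalLT X lam →
    ∃ Y : Set {S : Set X // HasCardinalLT S κ}, HasCardinalLT Y lam ∧ IsCofinal Y

section

variable (C : Type u) [Category.{v} C] (κ lam : Cardinal.{w}) [Fact κ.IsRegular]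

/-- The property of being a `(κ, lam)`-presentable object: the functor `Hom(A, -)` preserves
colimits of all `lam`-small `κ`-filtered diagrams. A category `J` is `lam`-small if it has fewer
than `lam` morphisms. -/
def IsPresentableBelow : ObjectProperty C := fun A =>
  ∀ (J : Type w) [SmallCategory J] [IsCardinalFiltered J κ], HasCardinalLT (Arrow J) lam →
    PreservesColimitsOfShape J (coyoneda.obj (op A))

/-- `(κ, lam)`-accessibly generated categories. -/
structure IsAccessiblyGenerated : Prop where
  essentiallySmall : EssentiallySmall.{w} C
  hasColimitsOfShape : ∀ (J : Type w) [SmallCategory J] [IsCardinalFiltered J κ],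
    HasCardinalLT (Arrow J) lam → HasColimitsOfShape J C
  exists_colimit : ∀ X : C, ∃ (J : Type w) (_ : SmallCategory J) (_ : IsCardinalFiltered J κ),
    HasCardinalLT (Arrow J) lam ∧ (IsPresentableBelow C κ lam).colimitsOfShape J X

end

section

variable (C : Type u) [Category.{w} C] (κ : Cardinal.{w}) [Fact κ.IsRegular]

/-- The presheaves on `C` that are colimits of small `κ`-filtered diagrams of representables. -/
def isKappaIndObject : ObjectProperty (Cᵒᵖ ⥤ Type w) := fun P =>
  ∃ (J : Type w) (_ : SmallCategory J) (_ : IsCardinalFiltered J κ) (F : J ⥤ C)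
    (c : F ⋙ yoneda ⟶ (Functor.const J).obj P), Nonempty (IsColimit (Cocone.mk P c))

/-- The free `κ`-ind-completion `Ind_κ(C)`, realised as the full subcategory of the category of
presheaves spanned by the colimits of small `κ`-filtered diagrams of representables. -/
abbrev KappaInd : Type (max u (w + 1)) := (isKappaIndObject C κ).FullSubcategory

end

/-- The full subcategory `K_κ(D)` of `κ`-presentable objects of `D`. -/
abbrev PresentableObjects (D : Type u) [Category.{v} D] (κ : Cardinal.{w}) [Fact κ.IsRegular] :
    Type u := (isCardinalPresentable D κ).FullSubcategory

end AccGen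

universe v' u'

/-! The passage from κ to λ rests on cutting a diagram F, indexed by a κ-directed poset α, into its
λ-small κ-directed subsets B. If κ ◁ λ, these subsets form a λ-directed poset, and colim F is the
colimit over it of the partial colimits colim F|B (`DirectedSubset.isColimitCocone`). Hence in a
κ-accessible D the λ-small κ-filtered colimits of κ-presentable objects are λ-presentable and
generate D under λ-filtered colimits. The case κ = λ only needs one-point diagrams.

(i) ⇒ (ii): let K be the (κ,λ)-presentable objects of C. Restricted Yoneda embeds C fully into D ≃
Ind_κ(K) and preserves λ-small κ-filtered colimits, so its image consists of the λ-small κ-filtered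
colimits of objects of K. These generate D under λ-filtered colimits, whence D ≃ Ind_λ(C).

(ii) ⇒ (iii): λ-presentable objects of Ind_λ(C) are retracts of representables, hence representable
since idempotents split in C.

(iii) ⇒ (i): a λ-presentable X is itself, not just up to retracts, a λ-small κ-filtered colimit of
κ-presentables (`isCardinalPresentable_le_smallFilteredColimits`). The identity of X factors through
some colim F|B, and a suitable enlargement of B turns this retraction into an isomorphism. -/

namespace AccGen

/-! ### Directed subsets and the sharp inequality -/

section Directed

variable {κ lam : Cardinal.{w}} [Fact κ.IsRegular] [Fact lam.IsRegular]

lemma exists_le_of_isCardinalFiltered {α : Type w} [Preorder α] [IsCardinalFiltered α κ]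
    {K : Type w} (f : K → α) (hK : HasCardinalLT K κ) : ∃ a, ∀ k, f k ≤ a :=
  ⟨IsCardinalFiltered.max f hK, fun k ↦ leOfHom (IsCardinalFiltered.toMax f hK k)⟩

lemma isCardinalFiltered_of_exists_le {α : Type w} [Preorder α]
    (h : ∀ ⦃K : Type w⦄ (f : K → α), HasCardinalLT K κ → ∃ a, ∀ k, f k ≤ a) :
    IsCardinalFiltered α κ :=
  isCardinalFiltered_preorder _ _ fun K f hK ↦
    h f (by rwa [hasCardinalLT_iff_cardinal_mk_lt])

lemma hasCardinalLT_arrow_of_preorder {α : Type w} [Preorder α] (hα : HasCardinalLT α lam) :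
    HasCardinalLT (Arrow α) lam :=
  (hasCardinalLT_prod (Cardinal.IsRegular.aleph0_le Fact.out) hα hα).of_injective
    (fun f : Arrow α ↦ (f.left, f.right)) fun f g h ↦ by
      obtain ⟨a, b, f⟩ := f
      obtain ⟨a', b', g⟩ := g
      obtain ⟨rfl, rfl⟩ : a = a' ∧ b = b' := by simpa using h
      obtain rfl : f = g := Subsingleton.elim _ _
      rfl

/-- The only place where the cofinality clause of κ ◁ λ enters; everything else uses κ < λ. -/
lemma IsSharplyLess.exists_superset (h : IsSharplyLess κ lam) {α : Type w} [PartialOrder α]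
    [IsCardinalFiltered α κ] (A : Set α) (hA : HasCardinalLT A lam) :
    ∃ B : Set α, A ⊆ B ∧ IsCardinalFiltered B κ ∧ HasCardinalLT B lam :=
  Cardinal.SharplyLT.exists_isCardinalFiltered_set_of_exists_cofinal h.1 h.2 A hA

/-- The type of pairs in `α × ι`, ordered in such a way that a pair is strictly below another one
when the second coordinate increases and the first coordinate of the larger one
dominates both the first coordinate of the smaller one and its image under `g`. -/
@[ext]
structure ClimbingPair {α : Type w} (g : α → α) (ι : Type w) where
  /-- the first coordinate -/
  fst : α
  /-- the second coordinate -/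
  snd : ι

instance {α : Type w} [Preorder α] (g : α → α) (ι : Type w) [Preorder ι] :
    PartialOrder (ClimbingPair g ι) where
  le x y := x = y ∨ (x.snd < y.snd ∧ x.fst ≤ y.fst ∧ g x.fst ≤ y.fst)
  le_refl x := Or.inl rfl
  le_trans := by
    rintro x y z (rfl | ⟨h₁, h₂, h₃⟩) (rfl | ⟨k₁, k₂, k₃⟩)
    · exact Or.inl rfl
    · exact Or.inr ⟨k₁, k₂, k₃⟩
    · exact Or.inr ⟨h₁, h₂, h₃⟩
    · exact Or.inr ⟨h₁.trans k₁, h₂.trans k₂, h₃.trans k₂⟩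
  le_antisymm := by
    rintro x y (rfl | ⟨h₁, -, -⟩) (h | ⟨k₁, -, -⟩)
    · rfl
    · rfl
    · exact h.symm
    · exact (lt_asymm h₁ k₁).elim

lemma ClimbingPair.le_def {α : Type w} [Preorder α] {g : α → α} {ι : Type w} [Preorder ι]
    {x y : ClimbingPair g ι} :
    x ≤ y ↔ x = y ∨ (x.snd < y.snd ∧ x.fst ≤ y.fst ∧ g x.fst ≤ y.fst) := Iff.rfl

lemma ClimbingPair.fst_mono {α : Type w} [Preorder α] {g : α → α} {ι : Type w} [Preorder ι]
    {x y : ClimbingPair g ι} (h : x ≤ y) : x.fst ≤ y.fst := by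
  obtain (rfl | h) := h
  · rfl
  · exact h.2.1

omit [Fact κ.IsRegular] [Fact lam.IsRegular] in
lemma hasCardinalLT_ord_toType_of_lt (h : κ < lam) : HasCardinalLT κ.ord.ToType lam := by
  simpa [hasCardinalLT_iff_cardinal_mk_lt]

/-- Any `lam`-small subset of a `κ`-directed poset is contained in a `lam`-small
`κ`-directed subset which is closed, up to domination, under a given function. -/
lemma IsSharplyLess.exists_superset_dominating (h : IsSharplyLess κ lam) {α : Type w}
    [PartialOrder α] [IsCardinalFiltered α κ] (g : α → α) (A : Set α)
    (hA : HasCardinalLT A lam) :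
    ∃ B : Set α, A ⊆ B ∧ IsCardinalFiltered B κ ∧ HasCardinalLT B lam ∧
      ∀ b ∈ B, ∃ b' ∈ B, g b ≤ b' := by
  let I := κ.ord.ToType
  have : NoMaxOrder I := Cardinal.noMaxOrder (Cardinal.IsRegular.aleph0_le Fact.out)
  have hlam : Cardinal.aleph0 ≤ lam := Cardinal.IsRegular.aleph0_le Fact.out
  obtain ⟨a₀⟩ := IsCardinalFiltered.nonempty α κ
  obtain ⟨i₀⟩ := IsCardinalFiltered.nonempty I κ
  have : IsCardinalFiltered (ClimbingPair g I) κ := isCardinalFiltered_of_exists_le fun K f hK ↦ by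
    obtain ⟨a, ha⟩ := exists_le_of_isCardinalFiltered (κ := κ) (fun k ↦ (f k).fst) hK
    obtain ⟨b, hb⟩ := exists_le_of_isCardinalFiltered (κ := κ) (fun k ↦ g (f k).fst) hK
    obtain ⟨i, hi⟩ := exists_le_of_isCardinalFiltered (κ := κ) (fun k ↦ (f k).snd) hK
    have := isFiltered_of_isCardinalFiltered α κ
    exact ⟨⟨IsFiltered.max a b, Order.succ i⟩, fun k ↦ Or.inr
      ⟨(hi k).trans_lt (Order.lt_succ i),
        (ha k).trans (leOfHom (IsFiltered.leftToMax a b)),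
        (hb k).trans (leOfHom (IsFiltered.rightToMax a b))⟩⟩
  -- The elements `(a₀, i)` force `B` to contain points of arbitrarily large second coordinate;
  -- there are only κ < λ of them.
  let A' : Set (ClimbingPair g I) :=
    Set.range (fun a : A ↦ ⟨a, i₀⟩) ∪ Set.range (fun i ↦ ⟨a₀, i⟩)
  obtain ⟨B, hAB, _, hB⟩ := h.exists_superset A' (hasCardinalLT_union hlam
    (hA.of_surjective _ Set.rangeFactorization_surjective)
    ((hasCardinalLT_ord_toType_of_lt h.1).of_surjective _ Set.rangeFactorization_surjective))
  refine ⟨ClimbingPair.fst '' B, ?_, isCardinalFiltered_of_exists_le ?_, ?_, ?_⟩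
  · intro a ha
    exact ⟨⟨a, i₀⟩, hAB (Or.inl ⟨⟨a, ha⟩, rfl⟩), rfl⟩
  · intro K f hK
    choose b hb hb' using fun k ↦ (f k).2
    obtain ⟨⟨m, hm⟩, hm'⟩ :=
      exists_le_of_isCardinalFiltered (κ := κ) (fun k ↦ (⟨b k, hb k⟩ : B)) hK
    refine ⟨⟨m.fst, m, hm, rfl⟩, fun k ↦ ?_⟩
    rw [← Subtype.coe_le_coe, ← hb']
    exact ClimbingPair.fst_mono (hm' k)
  · exact hB.of_surjective (fun b ↦ ⟨b.1.fst, b.1, b.2, rfl⟩) (by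
      rintro ⟨_, b, hb, rfl⟩
      exact ⟨⟨b, hb⟩, rfl⟩)
  · rintro _ ⟨b, hb, rfl⟩
    have := isFiltered_of_isCardinalFiltered B κ
    let x : B := ⟨b, hb⟩
    let y : B := ⟨⟨a₀, Order.succ b.snd⟩, hAB (Or.inr ⟨_, rfl⟩)⟩
    have hx : x ≤ IsFiltered.max x y := leOfHom (IsFiltered.leftToMax x y)
    have hy : y ≤ IsFiltered.max x y := leOfHom (IsFiltered.rightToMax x y)
    refine ⟨_, ⟨_, (IsFiltered.max x y).2, rfl⟩, ?_⟩
    -- The upper bound cannot equal `x`, since `y` has larger second coordinate. So it lies strictly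
    -- above `x`, and its first coordinate dominates `g`.
    obtain (hx | hx) := ClimbingPair.le_def.1 hx
    · rw [← Subtype.coe_le_coe, ← hx] at hy
      obtain (hy | hy) := ClimbingPair.le_def.1 hy
      · have := congr_arg ClimbingPair.snd hy
        exact ((Order.lt_succ b.snd).ne this.symm).elim
      · exact (lt_asymm (Order.lt_succ b.snd) hy.1).elim
    · exact hx.2.2

end Directed


/-! ### Closure under λ-small κ-filtered colimits -/

section SmallFilteredColimits

variable {D : Type u} [Category.{v} D]

/-- The objects which are colimits of `lam`-small `κ`-filtered diagrams of objects
satisfying `P`. -/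
def smallFilteredColimits (P : ObjectProperty D) (κ lam : Cardinal.{w}) [Fact κ.IsRegular] :
    ObjectProperty D := fun X ↦
  ∃ (J : Type w) (_ : SmallCategory J) (_ : IsCardinalFiltered J κ),
    HasCardinalLT (Arrow J) lam ∧ P.colimitsOfShape J X

variable {κ lam : Cardinal.{w}} [Fact κ.IsRegular] [Fact lam.IsRegular]

instance (P : ObjectProperty D) : (smallFilteredColimits P κ lam).IsClosedUnderIsomorphisms where
  of_iso := by
    rintro X Y e ⟨J, _, _, hJ, hX⟩
    exact ⟨J, inferInstance, inferInstance, hJ, ObjectProperty.prop_of_iso _ e hX⟩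

lemma le_smallFilteredColimits (P : ObjectProperty D) : P ≤ smallFilteredColimits P κ lam :=
  fun X hX ↦ ⟨PUnit, inferInstance, isCardinalFiltered_of_hasTerminal _ _,
    hasCardinalLT_arrow_of_preorder
      (hasCardinalLT_of_finite _ _ (Cardinal.IsRegular.aleph0_le Fact.out)),
    ⟨{ toColimitPresentation := .self X
       prop_diag_obj _ := hX }⟩⟩

lemma smallFilteredColimits_le_isCardinalPresentable [LocallySmall.{w} D] {P : ObjectProperty D}
    (hP : P ≤ isCardinalPresentable D κ) (h : κ ≤ lam) :
    smallFilteredColimits P κ lam ≤ isCardinalPresentable D lam := by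
  rintro X ⟨J, _, _, hJ, ⟨p⟩⟩
  exact p.isCardinalPresentable hP _ h hJ

omit [Fact lam.IsRegular] in
lemma smallFilteredColimits_le_colimitsCardinalClosure (P : ObjectProperty D) :
    smallFilteredColimits P κ lam ≤ P.colimitsCardinalClosure lam := by
  rintro X ⟨J, _, _, hJ, hX⟩
  have := P.isClosedUnderColimitsOfShape_colimitsCardinalClosure lam J hJ
  exact ObjectProperty.IsClosedUnderColimitsOfShape.colimitsOfShape_le
    (P := P.colimitsCardinalClosure lam) (J := J) _
    (ObjectProperty.colimitsOfShape_monotone J (P.le_colimitsCardinalClosure lam) _ hX)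

instance (P : ObjectProperty D) [LocallySmall.{w} D] [ObjectProperty.EssentiallySmall.{w} P] :
    ObjectProperty.EssentiallySmall.{w} (smallFilteredColimits P κ lam) :=
  .of_le (smallFilteredColimits_le_colimitsCardinalClosure P)

end SmallFilteredColimits

/-! ### Partial colimits over λ-small directed subsets -/

section DirectedSubset

/-- The poset of `lam`-small `κ`-directed subsets of a poset. -/
abbrev DirectedSubset (α : Type w) [PartialOrder α] (κ lam : Cardinal.{w}) [Fact κ.IsRegular] :
    Type w :=
  { B : Set α // IsCardinalFiltered B κ ∧ HasCardinalLT B lam }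

namespace DirectedSubset

variable {κ lam : Cardinal.{w}} [Fact κ.IsRegular] [Fact lam.IsRegular]
  {α : Type w} [PartialOrder α]

instance (B : DirectedSubset α κ lam) : IsCardinalFiltered B.1 κ := B.2.1

/-- The directed subset consisting of a single element. -/
abbrev single (a : α) : DirectedSubset α κ lam :=
  ⟨{a}, isCardinalFiltered_of_exists_le fun _ f _ ↦ ⟨⟨a, rfl⟩, fun k ↦ (f k).2.le⟩,
    hasCardinalLT_of_finite _ _ (Cardinal.IsRegular.aleph0_le Fact.out)⟩

/-- The directed subset consisting of two comparable elements. -/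
abbrev pair {a b : α} (h : a ≤ b) : DirectedSubset α κ lam :=
  ⟨{a, b}, isCardinalFiltered_of_exists_le fun _ f _ ↦ ⟨⟨b, by simp⟩, fun k ↦ by
    obtain (hk | hk) := (f k).2
    · exact hk.le.trans h
    · exact hk.le⟩,
    hasCardinalLT_of_finite _ _ (Cardinal.IsRegular.aleph0_le Fact.out)⟩

lemma single_le {a : α} {B : DirectedSubset α κ lam} (h : a ∈ B.1) : single a ≤ B := by
  rintro _ rfl
  exact h

lemma isCardinalFiltered (h : IsSharplyLess κ lam) [IsCardinalFiltered α κ] :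
    IsCardinalFiltered (DirectedSubset α κ lam) lam :=
  isCardinalFiltered_of_exists_le fun K f hK ↦ by
    obtain ⟨B, hB, hB₁, hB₂⟩ := h.exists_superset (⋃ k, (f k).1)
      (hasCardinalLT_iUnion _ hK fun k ↦ (f k).2.2)
    exact ⟨⟨B, hB₁, hB₂⟩, fun k ↦ (Set.subset_iUnion _ k).trans hB⟩

variable {D : Type u} [Category.{v} D] [HasCardinalFilteredColimits.{w} D κ] (F : α ⥤ D)

instance (B : DirectedSubset α κ lam) : HasColimitsOfShape B.1 D :=
  HasCardinalFilteredColimits.hasColimitsOfShape D κ _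

/-- The restriction of a functor to a directed subset. -/
abbrev restrict (B : DirectedSubset α κ lam) : B.1 ⥤ D :=
  (Subtype.mono_coe (· ∈ B.1)).functor ⋙ F

/-- The colimit of the restriction of a functor to a directed subset. -/
noncomputable abbrev partialColimit (B : DirectedSubset α κ lam) : D := colimit (restrict F B)

variable {F}

/-- The inclusion in a partial colimit. -/
noncomputable def ι (B : DirectedSubset α κ lam) {a : α} (ha : a ∈ B.1) :
    F.obj a ⟶ partialColimit F B :=
  colimit.ι (restrict F B) ⟨a, ha⟩

omit [Fact lam.IsRegular] in
lemma w (B : DirectedSubset α κ lam) {a b : α} (ha : a ∈ B.1) (hb : b ∈ B.1) (h : a ≤ b) :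
    F.map (homOfLE h) ≫ ι B hb = ι B ha :=
  colimit.w (restrict F B) 
    (homOfLE h : (⟨a, ha⟩ : B.1) ⟶ ⟨b, hb⟩)

omit [Fact lam.IsRegular] in
lemma hom_ext {B : DirectedSubset α κ lam} {Z : D} {f g : partialColimit F B ⟶ Z}
    (h : ∀ a (ha : a ∈ B.1), ι B ha ≫ f = ι B ha ≫ g) : f = g :=
  colimit.hom_ext fun a ↦ h a.1 a.2

/-- Constructor for morphisms from a partial colimit. -/
noncomputable def desc {B : DirectedSubset α κ lam} {Z : D}
    (f : ∀ a, a ∈ B.1 → (F.obj a ⟶ Z))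
    (hf : ∀ a b (ha : a ∈ B.1) (hb : b ∈ B.1) (h : a ≤ b),
      F.map (homOfLE h) ≫ f b hb = f a ha) :
    partialColimit F B ⟶ Z :=
  colimit.desc (restrict F B) (Cocone.mk Z
    { app a := f a.1 a.2
      naturality a b h := by
        simpa using! hf a.1 b.1 a.2 b.2 (leOfHom h) })

omit [Fact lam.IsRegular] in
@[simp]
lemma ι_desc {B : DirectedSubset α κ lam} {Z : D}
    (f : ∀ a, a ∈ B.1 → (F.obj a ⟶ Z))
    (hf : ∀ a b (ha : a ∈ B.1) (hb : b ∈ B.1) (h : a ≤ b),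
      F.map (homOfLE h) ≫ f b hb = f a ha) {a : α} (ha : a ∈ B.1) :
    ι B ha ≫ desc f hf = f a ha :=
  colimit.ι_desc _ _

omit [Fact lam.IsRegular] in
@[simp]
lemma ι_desc_assoc {B : DirectedSubset α κ lam} {Z Z' : D}
    (f : ∀ a, a ∈ B.1 → (F.obj a ⟶ Z))
    (hf : ∀ a b (ha : a ∈ B.1) (hb : b ∈ B.1) (h : a ≤ b),
      F.map (homOfLE h) ≫ f b hb = f a ha) {a : α} (ha : a ∈ B.1) (g : Z ⟶ Z') :
    ι B ha ≫ desc f hf ≫ g = f a ha ≫ g := by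
  rw [← Category.assoc, ι_desc]

variable (F κ lam) in
/-- The partial colimits form a functor. -/
noncomputable abbrev functor : DirectedSubset α κ lam ⥤ D where
  obj B := partialColimit F B
  map {B B'} h := desc (fun a ha ↦ ι B' (leOfHom h ha)) (fun _ _ _ _ h ↦ w _ _ _ h)
  map_id B := hom_ext fun a ha ↦ by simp
  map_comp f g := hom_ext fun a ha ↦ by simp

omit [Fact lam.IsRegular] in
lemma ι_map {B B' : DirectedSubset α κ lam} (h : B ⟶ B') {a : α} (ha : a ∈ B.1) :
    ι B ha ≫ (functor κ lam F).map h = ι B' (leOfHom h ha) :=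
  ι_desc (fun _ ha ↦ ι B' (leOfHom h ha)) (fun _ _ _ _ h ↦ w _ _ _ h) ha

omit [Fact lam.IsRegular] in
lemma ι_map_assoc {B B' : DirectedSubset α κ lam} (h : B ⟶ B') {a : α} (ha : a ∈ B.1) {Z : D}
    (f : (functor κ lam F).obj B' ⟶ Z) :
    ι B ha ≫ (functor κ lam F).map h ≫ f = ι B' (leOfHom h ha) ≫ f := by
  rw [← Category.assoc, ι_map]

/-- The cocone on the functor of partial colimits induced by a cocone. -/
noncomputable abbrev cocone (c : Cocone F) : Cocone (functor κ lam F) where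
  pt := c.pt
  ι.app B := desc (fun a _ ↦ c.ι.app a) (fun _ _ _ _ h ↦ c.w (homOfLE h))
  ι.naturality B B' h := hom_ext fun a ha ↦ by
    dsimp
    simp

omit [Fact lam.IsRegular] in
lemma ι_cocone (c : Cocone F) (B : DirectedSubset α κ lam) {a : α} (ha : a ∈ B.1) :
    ι B ha ≫ (cocone c).ι.app B = c.ι.app a :=
  ι_desc (fun a _ ↦ c.ι.app a) (fun _ _ _ _ h ↦ c.w (homOfLE h)) ha

/-- The colimit of the partial colimits is the colimit. -/
noncomputable def isColimitCocone {c : Cocone F} (hc : IsColimit c) :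
    IsColimit (cocone (κ := κ) (lam := lam) c) := by
  -- A cocone on the partial colimits is determined by its legs at singletons; pairs `a ≤ b` then
  -- give compatibility with the transition maps.
  have key (s : Cocone (functor κ lam F)) {B : DirectedSubset α κ lam} {a : α} (ha : a ∈ B.1) :
      ι (single a) (Set.mem_singleton a) ≫ s.ι.app (single a) = ι B ha ≫ s.ι.app B := by
    rw [← s.w (homOfLE (single_le ha) : single a ⟶ B), ι_map_assoc (homOfLE (single_le ha))]
  let d (s : Cocone (functor κ lam F)) : Cocone F :=
    { pt := s.pt
      ι :=
        { app a := ι (single a) (Set.mem_singleton a) ≫ s.ι.app (single a)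
          naturality a b h := by
            rw [key s (B := pair (leOfHom h)) (by simp),
              key s (B := pair (leOfHom h)) (by simp),
              ← w (pair (leOfHom h)) (by simp) (by simp) (leOfHom h), Category.assoc]
            simp
            rfl } }
  exact
    { desc s := hc.desc (d s)
      fac s B := hom_ext fun a ha ↦ by
        dsimp
        rw [ι_desc_assoc, hc.fac, ← key s ha]
      uniq s m hm := hc.hom_ext fun a ↦ by
        rw [hc.fac]
        dsimp [d]
        rw [← hm]
        dsimp
        rw [ι_desc_assoc] }

lemma smallFilteredColimits_partialColimit {P : ObjectProperty D} (hF : ∀ a, P (F.obj a))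
    (B : DirectedSubset α κ lam) : smallFilteredColimits P κ lam (partialColimit F B) :=
  ⟨B.1, inferInstance, inferInstance, hasCardinalLT_arrow_of_preorder B.2.2,
    ⟨.colimit (restrict F B) fun a ↦ hF a.1⟩⟩

end DirectedSubset

end DirectedSubset

/-! ### Presentable objects as small filtered colimits -/

section

variable {D : Type u} [Category.{v} D] {κ lam : Cardinal.{w}}
  [Fact κ.IsRegular] [Fact lam.IsRegular] [HasCardinalFilteredColimits.{w} D κ]

omit [HasCardinalFilteredColimits.{w} D κ] in
lemma exists_colimitsOfShape_partialOrder {P : ObjectProperty D} {X : D}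
    (h : ∃ (J : Type w) (_ : SmallCategory J) (_ : IsCardinalFiltered J κ),
      P.colimitsOfShape J X) :
    ∃ (α : Type w) (_ : PartialOrder α) (_ : IsCardinalFiltered α κ),
      P.colimitsOfShape α X := by
  obtain ⟨J, _, _, ⟨p⟩⟩ := h
  obtain ⟨α, _, _, G, _⟩ := IsCardinalFiltered.exists_cardinal_directed J κ
  exact ⟨α, inferInstance, inferInstance, ⟨p.reindex G⟩⟩

lemma exists_colimitsOfShape_smallFilteredColimits (h : κ = lam ∨ IsSharplyLess κ lam)
    {P : ObjectProperty D} {X : D}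
    (hX : ∃ (J : Type w) (_ : SmallCategory J) (_ : IsCardinalFiltered J κ),
      P.colimitsOfShape J X) :
    ∃ (J : Type w) (_ : SmallCategory J) (_ : IsCardinalFiltered J lam),
      (smallFilteredColimits P κ lam).colimitsOfShape J X := by
  obtain (rfl | h) := h
  · obtain ⟨J, _, _, hX⟩ := hX
    exact ⟨J, inferInstance, inferInstance,
      ObjectProperty.colimitsOfShape_monotone J (le_smallFilteredColimits P) _ hX⟩
  · obtain ⟨α, _, _, ⟨p⟩⟩ := exists_colimitsOfShape_partialOrder hX
    exact ⟨DirectedSubset α κ lam, inferInstance, DirectedSubset.isCardinalFiltered h,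
      ⟨{diag := _
        ι := _
        isColimit := DirectedSubset.isColimitCocone p.isColimit
        prop_diag_obj := DirectedSubset.smallFilteredColimits_partialColimit p.prop_diag_obj }⟩⟩

/-- In a `κ`-accessible category, if `κ ◁ lam`, then any `lam`-presentable object is a
colimit of a `lam`-small `κ`-filtered diagram of `κ`-presentable objects. -/
lemma isCardinalPresentable_le_smallFilteredColimits (h : κ = lam ∨ IsSharplyLess κ lam)
    {P : ObjectProperty D} (hP : P.IsCardinalFilteredGenerator κ) :
    isCardinalPresentable D lam ≤ smallFilteredColimits (isCardinalPresentable D κ) κ lam := by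
  intro X hX
  rw [isCardinalPresentable_iff] at hX
  obtain (rfl | h) := h
  · exact le_smallFilteredColimits _ _ hX
  obtain ⟨J, _, _, hX'⟩ := hP.exists_colimitsOfShape X
  obtain ⟨α, _, _, ⟨p⟩⟩ := exists_colimitsOfShape_partialOrder
    (κ := κ) ⟨J, inferInstance, inferInstance, ObjectProperty.colimitsOfShape_monotone J
      hP.le_isCardinalPresentable _ hX'⟩
  have := isFiltered_of_isCardinalFiltered α κ
  have := DirectedSubset.isCardinalFiltered (α := α) h
  have hF (a : α) : IsCardinalPresentable (p.diag.obj a) κ := p.prop_diag_obj a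
  obtain ⟨B, i, hi⟩ := IsCardinalPresentable.exists_hom_of_isColimit lam
    (DirectedSubset.isColimitCocone (κ := κ) (lam := lam) p.isColimit) (𝟙 X)
  -- By κ-presentability, F a → X → colim F|B lifts to some F b with b in B. The lift and the
  -- identity of F a agree in X, hence already at a stage c.
  have hg (a : α) : ∃ (b : α) (hb : b ∈ B.1) (c : α) (hac : a ≤ c) (hbc : b ≤ c)
      (f : p.diag.obj a ⟶ p.diag.obj b), f ≫ DirectedSubset.ι B hb = p.ι.app a ≫ i ∧
        f ≫ p.diag.map (homOfLE hbc) = p.diag.map (homOfLE hac) := by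
    obtain ⟨b, (f : p.diag.obj a ⟶ p.diag.obj b.1),
      (hf : f ≫ DirectedSubset.ι B b.2 = p.ι.app a ≫ i)⟩ :=
      IsCardinalPresentable.exists_hom_of_isColimit κ
        (colimit.isColimit (DirectedSubset.restrict p.diag B)) (p.ι.app a ≫ i)
    have hf' : f ≫ p.ι.app b.1 = 𝟙 _ ≫ p.ι.app a := by
      have hb : DirectedSubset.ι B b.2 ≫ (DirectedSubset.cocone p.cocone).ι.app B =
        p.ι.app b.1 := DirectedSubset.ι_cocone p.cocone B b.2
      rw [← hb, reassoc_of% hf, hi, Category.id_comp]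
      exact Category.comp_id _
    obtain ⟨c, u, v, huv⟩ := IsCardinalPresentable.exists_eq_of_isColimit κ p.isColimit f (𝟙 _) hf'
    exact ⟨b.1, b.2, c, leOfHom v, leOfHom u, f, hf,
      by rw [Category.id_comp] at huv; exact huv⟩
  choose b hb g hag hbg f hf hf' using hg
  -- One enlargement suffices: every `b a` lies in the original `B`, so `B'` only has to dominate
  -- the stages `g a` at which the lifts become transition maps.
  obtain ⟨B', hBB', h₁, h₂, hB'⟩ := h.exists_superset_dominating g B.1 B.2.2
  let B'' : DirectedSubset α κ lam := ⟨B', h₁, h₂⟩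
  let m : DirectedSubset.partialColimit p.diag B ⟶ DirectedSubset.partialColimit p.diag B'' :=
    (DirectedSubset.functor κ lam p.diag).map (homOfLE hBB' : B ⟶ B'')
  let r := (DirectedSubset.cocone (κ := κ) (lam := lam) p.cocone).ι.app B''
  have hmr : m ≫ r = (DirectedSubset.cocone p.cocone).ι.app B :=
    (DirectedSubset.cocone p.cocone).w (homOfLE hBB' : B ⟶ B'')
  let e : DirectedSubset.partialColimit p.diag B'' ≅ X :=
    { hom := r
      inv := i ≫ m
      hom_inv_id := DirectedSubset.hom_ext fun a ha ↦ by
        obtain ⟨a', ha', haa'⟩ := hB' a ha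
        have h₁ : DirectedSubset.ι B'' ha ≫ r = p.ι.app a :=
          DirectedSubset.ι_cocone p.cocone B'' ha
        have h₂ : DirectedSubset.ι B (hb a) ≫ m = DirectedSubset.ι B'' (hBB' (hb a)) :=
          DirectedSubset.ι_map (homOfLE hBB' : B ⟶ B'') (hb a)
        rw [reassoc_of% h₁, ← reassoc_of% (hf a), h₂, Category.comp_id,
          ← DirectedSubset.w B'' (hBB' (hb a)) ha' ((hbg a).trans haa'),
          ← DirectedSubset.w B'' ha ha' ((hag a).trans haa'),
          ← homOfLE_comp (hbg a) haa', ← homOfLE_comp (hag a) haa',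
          Functor.map_comp_assoc, Functor.map_comp_assoc, reassoc_of% (hf' a)]
      inv_hom_id := by rw [Category.assoc, hmr, hi] }
  exact ObjectProperty.prop_of_iso _ e
    (DirectedSubset.smallFilteredColimits_partialColimit p.prop_diag_obj B'')

end


/-! ### Filteredness of the index of an iterated colimit -/

section Total

open ColimitPresentation

variable {E : Type u} [Category.{v} E] {J : Type w} [SmallCategory J] {I : J → Type w}
  [∀ j, SmallCategory (I j)] {F : J ⥤ E} (P : ∀ j, ColimitPresentation (I j) (F.obj j))
  (κ : Cardinal.{w}) [Fact κ.IsRegular] [IsCardinalFiltered J κ]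
  [∀ j, IsCardinalFiltered (I j) κ] [∀ j i, IsFinitelyPresentable.{w} ((P j).diag.obj i)]

/-- The morphism in `Total P` induced by a morphism in one of the index categories. -/
abbrev totalMap {j : J} {i i' : I j} (f : i ⟶ i') : Total.mk P j i ⟶ Total.mk P j i' :=
  { base := 𝟙 _
    hom := (P j).diag.map f }

/-- Finite presentability is enough: each lifting problem involves a single morphism or equation,
and κ-filteredness of `J` and of the `I j` gathers fewer than κ solutions. -/
lemma isCardinalFiltered_total : IsCardinalFiltered (Total P) κ := by
  have (j : J) : IsFiltered (I j) := isFiltered_of_isCardinalFiltered (I j) κ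
  rw [isCardinalFiltered_iff]
  constructor
  · intro T x hT
    choose i f hf using fun t ↦ Total.exists_hom_of_hom (P := P) (x t).2
      (IsCardinalFiltered.toMax (fun t ↦ (x t).1) hT t)
    exact ⟨Total.mk P _ (IsCardinalFiltered.max i hT),
      fun t ↦ ⟨f t ≫ totalMap P (IsCardinalFiltered.toMax i hT t)⟩⟩
  · intro T k l f hT
    let φ (t : T) : k.1 ⟶ l.1 := (f t).base
    obtain ⟨i, g, hg⟩ := Total.exists_hom_of_hom (P := P) l.2 (IsCardinalFiltered.coeqHom φ hT)
    obtain ⟨i₀, g₀, hg₀⟩ := Total.exists_hom_of_hom (P := P) k.2 (IsCardinalFiltered.toCoeq φ hT)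
    have hfg (t : T) : ((f t).hom ≫ g.hom) ≫ (P _).ι.app i = g₀.hom ≫ (P _).ι.app i₀ := by
      rw [Category.assoc]
      erw [← g.w, ← g₀.w]
      rw [hg, hg₀, ← IsCardinalFiltered.coeq_condition φ hT t, F.map_comp]
      exact ((f t).w_assoc _).symm
    choose c p q hpq using fun t ↦ IsFinitelyPresentable.exists_eq_of_isColimit
      (P _).isColimit _ _ (hfg t)
    -- The maps `p t` and `q t` depend on `t`; coequalising first the `p'` and then the `q'` makes
    -- both independent of `t`.
    let p' (t : T) := p t ≫ IsCardinalFiltered.toMax c hT t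
    let q' (t : T) := q t ≫ IsCardinalFiltered.toMax c hT t ≫ IsCardinalFiltered.coeqHom p' hT
    refine ⟨Total.mk P _ (IsCardinalFiltered.coeq q' hT),
      g ≫ totalMap P (IsCardinalFiltered.toCoeq p' hT ≫ IsCardinalFiltered.coeqHom q' hT),
      g₀ ≫ totalMap P (IsCardinalFiltered.toCoeq q' hT), fun t ↦ Total.Hom.ext ?_ ?_⟩
    · have h : (f t).base ≫ g.base = g₀.base := by
        rw [hg, hg₀]
        exact IsCardinalFiltered.coeq_condition φ hT t
      exact (congr_arg ((f t).base ≫ ·) (Category.comp_id g.base)).trans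
        (h.trans (Category.comp_id g₀.base).symm)
    · have h₁ := IsCardinalFiltered.coeq_condition p' hT t
      have h₂ := IsCardinalFiltered.coeq_condition q' hT t
      have := hpq t
      simp only [Category.assoc] at this
      have h : (f t).hom ≫ g.hom ≫ (P _).diag.map
          (IsCardinalFiltered.toCoeq p' hT ≫ IsCardinalFiltered.coeqHom q' hT) =
          g₀.hom ≫ (P _).diag.map (IsCardinalFiltered.toCoeq q' hT) := by
        rw [← h₁, ← h₂]
        simp only [p', q', Functor.map_comp, Category.assoc, reassoc_of% this]
      exact h

end Total

/-! ### Presentability along fully faithful functors -/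

section FullyFaithful

variable {A : Type u} [Category.{v} A] {B : Type u'} [Category.{v} B]

/-- A fully faithful functor reflects the property that `Hom(X, -)` preserves a colimit,
when the functor itself preserves this colimit. -/
lemma preservesColimit_coyoneda_of_fullyFaithful (F : A ⥤ B) [F.Full] [F.Faithful]
    {J : Type*} [Category* J] (G : J ⥤ A) [PreservesColimit G F] (X : A)
    [PreservesColimit (G ⋙ F) (coyoneda.obj (op (F.obj X)))] :
    PreservesColimit G (coyoneda.obj (op X)) :=
  preservesColimit_of_natIso G
    (NatIso.ofComponents (fun Y ↦ (Functor.FullyFaithful.ofFullyFaithful F).homEquiv.symm.toIso)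
      (fun f ↦ by ext; apply F.map_injective; simp) :
        F ⋙ coyoneda.obj (op (F.obj X)) ≅ coyoneda.obj (op X))

lemma isCardinalPresentable_of_fullyFaithful (F : A ⥤ B) [F.Full] [F.Faithful]
    (κ : Cardinal.{w}) [Fact κ.IsRegular] [F.IsCardinalAccessible κ] (X : A)
    [IsCardinalPresentable (F.obj X) κ] : IsCardinalPresentable X κ where
  preservesColimitOfShape J _ _ := by
    have := F.preservesColimitsOfShape_of_isCardinalAccessible κ J
    have := preservesColimitsOfShape_of_isCardinalPresentable (F.obj X) κ J
    exact ⟨fun {G} ↦ preservesColimit_coyoneda_of_fullyFaithful F G X⟩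

end FullyFaithful

/-! ### The free ind-completion -/

section KappaInd

variable (C : Type u) [Category.{w} C] (κ : Cardinal.{w}) [Fact κ.IsRegular]

variable {C} in
instance isCardinalPresentable_yoneda_obj (X : C) :
    IsCardinalPresentable (yoneda.obj X) κ where
  preservesColimitOfShape J _ _ :=
    preservesColimitsOfShape_of_natIso
      (NatIso.ofComponents (fun P ↦ (yonedaEquiv.trans Equiv.ulift.symm).toIso) :
        coyoneda.obj (op (yoneda.obj X)) ≅
          (evaluation Cᵒᵖ (Type w)).obj (op X) ⋙ uliftFunctor.{u}).symm

variable {C κ}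

lemma isKappaIndObject_of_colimitPresentation {P : Cᵒᵖ ⥤ Type w} {J : Type u'} [Category.{v'} J]
    [EssentiallySmall.{w} J] [IsCardinalFiltered J κ] (p : ColimitPresentation J P)
    (hp : ∀ j, yoneda.essImage (p.diag.obj j)) : isKappaIndObject C κ P := by
  have := IsCardinalFiltered.of_equivalence κ (equivSmallModel.{w} J)
  let q := (p.changeDiag (Functor.essImage.liftFunctorCompIso p.diag yoneda hp)).reindex
    (equivSmallModel.{w} J).inverse
  exact ⟨SmallModel.{w} J, inferInstance, inferInstance,
    (equivSmallModel.{w} J).inverse ⋙ Functor.essImage.liftFunctor p.diag yoneda hp,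
    q.ι, ⟨q.isColimit⟩⟩

lemma isKappaIndObject.exists_colimitPresentation {P : Cᵒᵖ ⥤ Type w}
    (hP : isKappaIndObject C κ P) :
    ∃ (J : Type w) (_ : SmallCategory J) (_ : IsCardinalFiltered J κ)
      (p : ColimitPresentation J P), ∀ j, ∃ X, p.diag.obj j = yoneda.obj X := by
  obtain ⟨J, _, _, F, c, ⟨hc⟩⟩ := hP
  exact ⟨J, inferInstance, inferInstance, ⟨_, c, hc⟩, fun j ↦ ⟨_, rfl⟩⟩

lemma isKappaIndObject_yoneda_obj (X : C) : isKappaIndObject C κ (yoneda.obj X) := by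
  have : IsCardinalFiltered (PUnit.{w + 1}) κ := isCardinalFiltered_of_hasTerminal _ _
  exact isKappaIndObject_of_colimitPresentation
    (ColimitPresentation.self.{w} (yoneda.obj X)) fun _ ↦ yoneda.obj_mem_essImage X

/-- A colimit of colimits of representables is a single colimit over the total category, which is
κ-filtered and essentially small. -/
instance isClosedUnderColimitsOfShape_isKappaIndObject (J : Type w) [SmallCategory J]
    [IsCardinalFiltered J κ] : (isKappaIndObject C κ).IsClosedUnderColimitsOfShape J where
  colimitsOfShape_le P := by
    rintro ⟨p⟩
    choose I _ _ q X hX using fun j ↦ (p.prop_diag_obj j).exists_colimitPresentation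
    have hq (j : J) (i : I j) : IsFinitelyPresentable.{w} ((q j).diag.obj i) := by
      rw [hX]
      have : Fact Cardinal.aleph0.{w}.IsRegular := Cardinal.fact_isRegular_aleph0
      exact isCardinalPresentable_yoneda_obj _ _
    have (j : J) : IsFiltered (I j) := isFiltered_of_isCardinalFiltered (I j) κ
    have := isCardinalFiltered_total q κ
    have (k l : ColimitPresentation.Total q) : Small.{w} ((q k.1).diag.obj k.2 ⟶
        (q l.1).diag.obj l.2) := by
      rw [hX, hX]
      exact small_of_injective yonedaEquiv.injective
    have : LocallySmall.{w} (ColimitPresentation.Total q) :=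
      ⟨fun k l ↦ small_of_injective
        (β := (k.1 ⟶ l.1) × ((q k.1).diag.obj k.2 ⟶ (q l.1).diag.obj l.2))
        (f := fun x ↦ (x.base, x.hom)) fun x y h ↦
          ColimitPresentation.Total.Hom.ext (congr_arg Prod.fst h) (congr_arg Prod.snd h)⟩
    have : Small.{w} (ColimitPresentation.Total q) := by
      dsimp only [ColimitPresentation.Total]
      infer_instance
    have := essentiallySmall_of_small_of_locallySmall.{w} (ColimitPresentation.Total q)
    refine isKappaIndObject_of_colimitPresentation (p.toColimitPresentation.bind q) fun k ↦ ?_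
    change yoneda.essImage ((q k.1).diag.obj k.2)
    rw [hX]
    exact yoneda.obj_mem_essImage _

instance : HasCardinalFilteredColimits.{w} (KappaInd C κ) κ where
  hasColimitsOfShape _ _ _ := inferInstance

instance : (isKappaIndObject C κ).ι.IsCardinalAccessible κ where
  preservesColimitOfShape _ _ _ := inferInstance

/-- By Yoneda, a morphism out of a colimit of representables is determined by a small family of
elements. -/
instance : LocallySmall.{w} (KappaInd C κ) where
  hom_small P Q := by
    obtain ⟨J, _, _, F, c, ⟨hc⟩⟩ := P.property
    refine small_of_injective (β := ∀ j, Q.obj.obj (op (F.obj j)))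
      (f := fun φ j ↦ yonedaEquiv (c.app j ≫ φ.hom)) fun φ ψ h ↦ ?_
    ext1
    exact hc.hom_ext fun j ↦ yonedaEquiv.injective (congr_fun h j)

variable (C κ) in
/-- The Yoneda embedding with values in the free `κ`-ind-completion. -/
abbrev yonedaInd : C ⥤ KappaInd C κ :=
  (isKappaIndObject C κ).lift yoneda isKappaIndObject_yoneda_obj

instance (X : C) : IsCardinalPresentable ((yonedaInd C κ).obj X) κ := by
  have : IsCardinalPresentable ((isKappaIndObject C κ).ι.obj ((yonedaInd C κ).obj X)) κ :=
    isCardinalPresentable_yoneda_obj κ X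
  exact isCardinalPresentable_of_fullyFaithful (isKappaIndObject C κ).ι κ _

lemma isCardinalFilteredGenerator_essImage_yonedaInd :
    (yonedaInd C κ).essImage.IsCardinalFilteredGenerator κ where
  le_isCardinalPresentable := by
    rintro _ ⟨X, ⟨e⟩⟩
    exact isCardinalPresentable_of_iso e κ
  exists_colimitsOfShape P := by
    obtain ⟨J, _, _, F, c, ⟨hc⟩⟩ := P.property
    let c' : Cocone (F ⋙ yonedaInd C κ) :=
      { pt := P
        ι :=
          { app j := ObjectProperty.homMk (c.app j)
            naturality i j f := by
              ext1
              exact c.naturality f } }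
    have hc' : IsColimit ((isKappaIndObject C κ).ι.mapCocone c') := hc
    exact ⟨J, inferInstance, inferInstance,
      ⟨{diag := _
        ι := c'.ι
        isColimit := isColimitOfReflects (isKappaIndObject C κ).ι hc'
        prop_diag_obj j := Functor.obj_mem_essImage _ _ }⟩⟩

lemma isCardinalAccessibleCategory_kappaInd [EssentiallySmall.{w} C] :
    IsCardinalAccessibleCategory (KappaInd C κ) κ where
  toHasCardinalFilteredGenerator :=
    isCardinalFilteredGenerator_essImage_yonedaInd.hasCardinalFilteredGenerator

end KappaInd


/-! ### Restricted Yoneda functors and recognition of ind-completions -/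

section Nerve

variable {A : Type u} [Category.{w} A] {B : Type u'} [Category.{w} B] (ι : A ⥤ B)

/-- The functor which sends `b` to the presheaf `Hom(ι -, b)`. -/
abbrev restrictedHom : B ⥤ Aᵒᵖ ⥤ Type w :=
  yoneda ⋙ (Functor.whiskeringLeft _ _ _).obj ι.op

lemma preservesColimit_restrictedHom {J : Type*} [Category* J] (G : J ⥤ B)
    [∀ a, PreservesColimit G (coyoneda.obj (op (ι.obj a)))] :
    PreservesColimit G (restrictedHom ι) where
  preserves hc := ⟨evaluationJointlyReflectsColimits _ fun a ↦
    isColimitOfPreserves (coyoneda.obj (op (ι.obj a.unop))) hc⟩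

/-- The restricted Yoneda functor of a fully faithful functor extends the Yoneda embedding. -/
noncomputable def compRestrictedHomIso [ι.Full] [ι.Faithful] : ι ⋙ restrictedHom ι ≅ yoneda :=
  NatIso.ofComponents (fun a ↦ NatIso.ofComponents
    (fun b ↦ (Functor.FullyFaithful.ofFullyFaithful ι).homEquiv.symm.toIso)
    (fun f ↦ by ext; apply ι.map_injective; simp))
    (fun f ↦ by ext; apply ι.map_injective; simp)

variable (κ : Cardinal.{w}) [Fact κ.IsRegular]

/-- The property that any object is the colimit of a small `κ`-filtered diagram of objects in the
image of `ι`, and that this colimit is preserved by the functors `Hom(ι a, -)`. -/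
def IsIndDense : Prop :=
  ∀ b : B, ∃ (J : Type w) (_ : SmallCategory J) (_ : IsCardinalFiltered J κ) (G : J ⥤ A)
    (c : G ⋙ ι ⟶ (Functor.const J).obj b), Nonempty (IsColimit (Cocone.mk b c)) ∧
      ∀ a, PreservesColimit (G ⋙ ι) (coyoneda.obj (op (ι.obj a)))

variable {ι κ}

lemma IsIndDense.mk [ι.Full] [ι.Faithful]
    (h : ∀ b : B, ∃ (J : Type w) (_ : SmallCategory J) (_ : IsCardinalFiltered J κ)
      (p : ι.essImage.ColimitOfShape J b),
      ∀ a, PreservesColimit p.diag (coyoneda.obj (op (ι.obj a)))) : IsIndDense ι κ := by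
  intro b
  obtain ⟨J, _, _, p, hp⟩ := h b
  let e := Functor.essImage.liftFunctorCompIso p.diag ι p.prop_diag_obj
  exact ⟨J, inferInstance, inferInstance, Functor.essImage.liftFunctor p.diag ι p.prop_diag_obj,
    (p.changeDiag e).ι, ⟨(p.changeDiag e).isColimit⟩,
    fun a ↦ preservesColimit_of_iso_diagram _ e.symm⟩

namespace IsIndDense

variable (h : IsIndDense ι κ)

include h

/-- Only the chosen colimit has to be preserved. This permits `B = C`, which need not have all small
κ-filtered colimits, with `A` its (κ,λ)-presentable objects. -/
lemma isKappaIndObject [ι.Full] [ι.Faithful] (b : B) :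
    isKappaIndObject A κ ((restrictedHom ι).obj b) := by
  obtain ⟨J, _, _, G, c, ⟨hc⟩, _⟩ := h b
  have := preservesColimit_restrictedHom ι (G ⋙ ι)
  let p : ColimitPresentation J ((restrictedHom ι).obj b) :=
    ⟨_, ((restrictedHom ι).mapCocone (Cocone.mk b c)).ι,
      isColimitOfPreserves (restrictedHom ι) hc⟩
  exact isKappaIndObject_of_colimitPresentation p
    fun j ↦ ⟨G.obj j, ⟨(compRestrictedHomIso ι).symm.app (G.obj j)⟩⟩

lemma faithful_restrictedHom : (restrictedHom ι).Faithful where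
  map_injective {X Y f g} hfg := by
    obtain ⟨J, _, _, G, c, ⟨hc⟩, -⟩ := h X
    exact hc.hom_ext fun j ↦ ConcreteCategory.congr_hom
      (NatTrans.congr_app hfg (op (G.obj j))) (c.app j)

/-- A natural transformation acts on the colimit legs to give a cocone, hence a morphism. It induces
the given transformation because every `ι a ⟶ X` factors through a leg. -/
lemma full_restrictedHom [ι.Full] : (restrictedHom ι).Full where
  map_surjective {X Y} φ := by
    obtain ⟨J, _, _, G, c, ⟨hc⟩, _⟩ := h X
    have hφ {a a' : A} (f : a ⟶ a') (x : ι.obj a' ⟶ X) :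
        φ.app (op a) (ι.map f ≫ x) = ι.map f ≫ φ.app (op a') x :=
      NatTrans.naturality_apply φ f.op x
    let s : Cocone (G ⋙ ι) :=
      { pt := Y
        ι :=
          { app j := φ.app (op (G.obj j)) (c.app j)
            naturality i j f := by
              refine (hφ (G.map f) (c.app j)).symm.trans ?_
              have := c.naturality f
              dsimp at this ⊢
              rw [this, Category.comp_id, Category.comp_id] } }
    refine ⟨hc.desc s, ?_⟩
    ext ⟨a⟩ (x : ι.obj a ⟶ X)
    obtain ⟨j, y, hy⟩ := exists_hom_of_preservesColimit_coyoneda hc x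
    obtain ⟨y, rfl⟩ := ι.map_surjective y
    change x ≫ hc.desc s = φ.app (op a) x
    rw [← hy, Category.assoc, hc.fac]
    exact (hφ y (c.app j)).symm

variable [ι.Full] [ι.Faithful]

/-- The restricted Yoneda functor, with values in the free `κ`-ind-completion. -/
noncomputable abbrev toKappaInd : B ⥤ KappaInd A κ :=
  (AccGen.isKappaIndObject A κ).lift (restrictedHom ι) h.isKappaIndObject

lemma faithful_toKappaInd : h.toKappaInd.Faithful :=
  have := h.faithful_restrictedHom
  inferInstance

lemma full_toKappaInd : h.toKappaInd.Full :=
  have := h.full_restrictedHom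
  inferInstance

/-- The functor to the free `κ`-ind-completion extends the Yoneda embedding. -/
noncomputable def compToKappaIndIso : ι ⋙ h.toKappaInd ≅ yonedaInd A κ :=
  NatIso.ofComponents
    (fun a ↦ (AccGen.isKappaIndObject A κ).isoMk ((compRestrictedHomIso ι).app a))
    (fun f ↦ by ext1; exact (compRestrictedHomIso ι).hom.naturality f)

lemma preservesColimit_toKappaInd {J : Type*} [Category* J] (G : J ⥤ B)
    [∀ a, PreservesColimit G (coyoneda.obj (op (ι.obj a)))] :
    PreservesColimit G h.toKappaInd :=
  have := preservesColimit_restrictedHom ι G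
  have : PreservesColimit G (h.toKappaInd ⋙ (AccGen.isKappaIndObject A κ).ι) := this
  preservesColimit_of_reflects_of_preserves _ (AccGen.isKappaIndObject A κ).ι

/-- If `B` is generated under `κ`-filtered colimits by a full subcategory `A` of
`κ`-presentable objects, then `B` is the free `κ`-ind-completion of `A`. -/
lemma nonempty_equivalence [HasCardinalFilteredColimits.{w} B κ]
    (hι : ∀ a, IsCardinalPresentable (ι.obj a) κ) : Nonempty (B ≌ KappaInd A κ) := by
  have := h.faithful_toKappaInd
  have := h.full_toKappaInd
  have : h.toKappaInd.EssSurj :=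
    { mem_essImage P := by
        obtain ⟨J, _, _, ⟨p⟩⟩ :=
          isCardinalFilteredGenerator_essImage_yonedaInd.exists_colimitsOfShape P
        have := HasCardinalFilteredColimits.hasColimitsOfShape B κ J
        have (a : A) := preservesColimitsOfShape_of_isCardinalPresentable (ι.obj a) κ J
        have : PreservesColimitsOfShape J h.toKappaInd :=
          ⟨fun {G} ↦ h.preservesColimit_toKappaInd G⟩
        -- The essential image of a fully faithful functor preserving these colimits is closed under
        -- them, and it contains the representables.
        refine ObjectProperty.IsClosedUnderColimitsOfShape.colimitsOfShape_le
          (P := h.toKappaInd.essImage) (J := J) P ⟨p.ofLE ?_⟩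
        rintro _ ⟨a, ⟨e⟩⟩
        exact ⟨ι.obj a, ⟨h.compToKappaIndIso.app a ≪≫ e⟩⟩ }
  have : h.toKappaInd.IsEquivalence := { }
  exact ⟨h.toKappaInd.asEquivalence⟩

end IsIndDense

end Nerve

/-! ### Recovering a category from its presentable objects -/

section IdempotentComplete

variable {C : Type u} [Category.{v} C] {D : Type u'} [Category.{v'} D] {lam : Cardinal.{w}}
  [Fact lam.IsRegular]

lemma nonempty_equivalence_presentableObjects [IsIdempotentComplete C] (F : C ⥤ D) [F.Full]
    [F.Faithful] (hF : F.essImage.IsCardinalFilteredGenerator lam) :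
    Nonempty (C ≌ PresentableObjects D lam) := by
  let G : C ⥤ PresentableObjects D lam := (isCardinalPresentable D lam).lift F fun X ↦
    hF.le_isCardinalPresentable _ (F.obj_mem_essImage X)
  have : G.EssSurj :=
    { mem_essImage Y := by
        obtain ⟨_, ⟨X, ⟨e⟩⟩, ⟨r⟩⟩ := hF.isPresentable_eq_retractClosure.le _ Y.property
        obtain ⟨i, q, hiq⟩ : ∃ (i : Y.obj ⟶ F.obj X) (q : F.obj X ⟶ Y.obj), i ≫ q = 𝟙 _ :=
          ⟨r.i ≫ e.inv, e.hom ≫ r.r, by simp⟩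
        -- The idempotent of `F.obj X` with image `Y` lifts to `X`; the object splitting it there is
        -- sent to `Y`.
        obtain ⟨p, hp⟩ := F.map_surjective (q ≫ i)
        obtain ⟨Z, j, s, hjs, hsj⟩ := IsIdempotentComplete.idempotents_split X p
          (F.map_injective (by simp [hp, reassoc_of% hiq]))
        have hj : F.map j ≫ q ≫ i = F.map j := by
          rw [← hp, ← F.map_comp, ← hsj, reassoc_of% hjs]
        refine ⟨Z, ⟨(isCardinalPresentable D lam).isoMk
          { hom := F.map j ≫ q
            inv := i ≫ F.map s
            hom_inv_id := ?_
            inv_hom_id := ?_ }⟩⟩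
        · change (F.map j ≫ q) ≫ i ≫ F.map s = 𝟙 (F.obj Z)
          rw [Category.assoc, ← Category.assoc q, ← Category.assoc, hj, ← F.map_comp, hjs,
            F.map_id]
        · change (i ≫ F.map s) ≫ F.map j ≫ q = 𝟙 Y.obj
          rw [Category.assoc, ← F.map_comp_assoc, hsj, hp, Category.assoc, hiq,
            Category.comp_id, hiq] }
  have : G.IsEquivalence := { }
  exact ⟨G.asEquivalence⟩

end IdempotentComplete

/-! ### Invariance under equivalence -/

section Transport

variable {κ lam : Cardinal.{w}} [Fact κ.IsRegular]

lemma IsPresentableBelow.of_equivalence {C : Type u} [Category.{v} C] {D : Type u'}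
    [Category.{v} D] (e : C ≌ D) {X : C} (hX : IsPresentableBelow C κ lam X) :
    IsPresentableBelow D κ lam (e.functor.obj X) := by
  intro J _ _ hJ
  have := hX J hJ
  exact preservesColimitsOfShape_of_natIso
    (NatIso.ofComponents (fun Y ↦ (e.toAdjunction.homEquiv X Y).symm.toIso)
      (fun f ↦ by ext; simp [Adjunction.homEquiv_counit]) :
      e.inverse ⋙ coyoneda.obj (op X) ≅ coyoneda.obj (op (e.functor.obj X)))

lemma IsAccessiblyGenerated.of_equivalence {C : Type u} [Category.{v} C] {D : Type u'}
    [Category.{v} D] (e : C ≌ D) (hC : IsAccessiblyGenerated C κ lam) :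
    IsAccessiblyGenerated D κ lam where
  essentiallySmall := (essentiallySmall_congr e).1 hC.essentiallySmall
  hasColimitsOfShape J _ _ hJ :=
    have := hC.hasColimitsOfShape J hJ
    Adjunction.hasColimitsOfShape_of_equivalence e.inverse
  exists_colimit Y := by
    obtain ⟨J, _, _, hJ, ⟨p⟩⟩ := hC.exists_colimit (e.inverse.obj Y)
    exact ⟨J, inferInstance, inferInstance, hJ, ObjectProperty.prop_of_iso _
      (e.counitIso.app Y) ⟨{
        toColimitPresentation := p.toColimitPresentation.map e.functor
        prop_diag_obj j := (p.prop_diag_obj j).of_equivalence e }⟩⟩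

end Transport

/-! ### The three implications -/

section

variable {κ lam : Cardinal.{w}} [Fact κ.IsRegular] [Fact lam.IsRegular]

omit [Fact κ.IsRegular] [Fact lam.IsRegular] in
lemma le_of_eq_or_isSharplyLess (h : κ = lam ∨ IsSharplyLess κ lam) : κ ≤ lam :=
  h.elim (fun h ↦ h.le) (fun h ↦ h.1.le)

section

variable (D : Type u) [Category.{v} D]

lemma isCardinalFilteredGenerator_smallFilteredColimits (h : κ = lam ∨ IsSharplyLess κ lam)
    [LocallySmall.{w} D] [HasCardinalFilteredColimits.{w} D κ] {P : ObjectProperty D}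
    (hP : P.IsCardinalFilteredGenerator κ) :
    (smallFilteredColimits P κ lam).IsCardinalFilteredGenerator lam where
  le_isCardinalPresentable := smallFilteredColimits_le_isCardinalPresentable
    hP.le_isCardinalPresentable (le_of_eq_or_isSharplyLess h)
  exists_colimitsOfShape X :=
    exists_colimitsOfShape_smallFilteredColimits h (hP.exists_colimitsOfShape X)

lemma essentiallySmall_presentableObjects (h : κ = lam ∨ IsSharplyLess κ lam)
    [IsCardinalAccessibleCategory D κ] : EssentiallySmall.{w} (PresentableObjects D lam) := by
  obtain ⟨P, _, hP⟩ := HasCardinalFilteredGenerator.exists_generator D κ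
  have := (isCardinalFilteredGenerator_smallFilteredColimits D h hP).essentiallySmall_isPresentable
  infer_instance

lemma isAccessiblyGenerated_presentableObjects (h : κ = lam ∨ IsSharplyLess κ lam)
    [IsCardinalAccessibleCategory D κ] :
    IsAccessiblyGenerated (PresentableObjects D lam) κ lam where
  essentiallySmall := essentiallySmall_presentableObjects D h
  hasColimitsOfShape J _ _ hJ := by
    have := HasCardinalFilteredColimits.hasColimitsOfShape D κ J
    have := isClosedUnderColimitsOfShape_isCardinalPresentable D hJ
    infer_instance
  exists_colimit X := by
    have le := le_of_eq_or_isSharplyLess h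
    have key : isCardinalPresentable D κ ≤ isCardinalPresentable D lam :=
      isCardinalPresentable_monotone D le
    obtain ⟨J, _, _, hJ, ⟨p⟩⟩ := isCardinalPresentable_le_smallFilteredColimits h
      (isCardinalFilteredGenerator_isCardinalPresentable D κ) X.obj X.property
    let G : J ⥤ PresentableObjects D lam :=
      (isCardinalPresentable D lam).lift p.diag fun j ↦ key _ (p.prop_diag_obj j)
    let c : Cocone G :=
      { pt := X
        ι :=
          { app j := ObjectProperty.homMk (p.ι.app j)
            naturality i j f := by
              ext1
              exact p.ι.naturality f } }
    have hc : IsColimit ((isCardinalPresentable D lam).ι.mapCocone c) := p.isColimit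
    refine ⟨J, inferInstance, inferInstance, hJ, ⟨{
      diag := G
      ι := c.ι
      isColimit := isColimitOfReflects (isCardinalPresentable D lam).ι hc
      prop_diag_obj j := ?_ }⟩⟩
    -- The inclusion into `D` preserves λ-small κ-filtered colimits, so κ-presentability in `D`
    -- gives (κ,λ)-presentability in the subcategory.
    intro K _ _ hK
    have := HasCardinalFilteredColimits.hasColimitsOfShape D κ K
    have := isClosedUnderColimitsOfShape_isCardinalPresentable D hK
    have : IsCardinalPresentable (p.diag.obj j) κ := p.prop_diag_obj j
    have : PreservesColimitsOfShape K
        (coyoneda.obj (op ((isCardinalPresentable D lam).ι.obj (G.obj j)))) :=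
      preservesColimitsOfShape_of_isCardinalPresentable (p.diag.obj j) κ K
    exact ⟨fun {F} ↦
      preservesColimit_coyoneda_of_fullyFaithful (isCardinalPresentable D lam).ι F _⟩

end

variable {C : Type u} [Category.{w} C]

lemma exists_presentableObjects_equivalence [IsIdempotentComplete C]
    [IsCardinalAccessibleCategory (KappaInd C lam) κ] :
    ∃ (D : Type (w + 1)) (_ : Category.{w} D), IsCardinalAccessibleCategory D κ ∧
      Nonempty (C ≌ PresentableObjects D lam) := by
  -- `D` is a model with objects and morphisms in the universes demanded by the statement.
  obtain ⟨D, _, ⟨e⟩⟩ := HasCardinalFilteredGenerator.exists_equivalence (KappaInd C lam) κ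
  refine ⟨D, inferInstance, e.isCardinalAccessibleCategory κ, ?_⟩
  let Y : C ⥤ D := yonedaInd C lam ⋙ e.functor
  refine nonempty_equivalence_presentableObjects Y
    ((e.toAdjunction.isCardinalFilteredGenerator
      isCardinalFilteredGenerator_essImage_yonedaInd).of_le_isoClosure ?_ ?_)
  · refine le_trans ?_ (ObjectProperty.le_isoClosure _)
    rintro _ ⟨_, ⟨X, ⟨e₁⟩⟩, ⟨e₂⟩⟩
    exact ⟨X, ⟨e.functor.mapIso e₁ ≪≫ e₂⟩⟩
  · rintro _ ⟨X, ⟨e₁⟩⟩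
    have : IsCardinalPresentable (Y.obj X) lam :=
      isCardinalPresentable_of_equivalence ((yonedaInd C lam).obj X) lam e
    exact isCardinalPresentable_of_iso e₁ lam

namespace IsAccessiblyGenerated

variable (hC : IsAccessiblyGenerated C κ lam)

include hC

omit [Fact lam.IsRegular] in
lemma isIndDense_ι : IsIndDense (IsPresentableBelow C κ lam).ι κ := .mk fun X ↦ by
  obtain ⟨J, _, _, hJ, ⟨p⟩⟩ := hC.exists_colimit X
  refine ⟨J, inferInstance, inferInstance, p.ofLE fun Y hY ↦ ⟨⟨Y, hY⟩, ⟨Iso.refl _⟩⟩, fun a ↦ ?_⟩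
  have := a.property J hJ
  dsimp
  infer_instance

lemma isCardinalAccessibleCategory_kappaInd (h : κ = lam ∨ IsSharplyLess κ lam) :
    IsCardinalAccessibleCategory (KappaInd C lam) κ := by
  have := hC.essentiallySmall
  let K := (IsPresentableBelow C κ lam).FullSubcategory
  have hK := hC.isIndDense_ι
  have := hK.faithful_toKappaInd
  have := hK.full_toKappaInd
  have : ObjectProperty.EssentiallySmall.{w} (IsPresentableBelow C κ lam) := .of_le le_top
  have : EssentiallySmall.{w} K := inferInstance
  have : IsCardinalAccessibleCategory (KappaInd K κ) κ :=
    AccGen.isCardinalAccessibleCategory_kappaInd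
  -- The restricted Yoneda functor of `Y` needs morphisms of `D` in universe `w`.
  obtain ⟨D, _, ⟨e⟩⟩ := HasCardinalFilteredGenerator.exists_equivalence (KappaInd K κ) κ
  have : IsCardinalAccessibleCategory D κ := e.isCardinalAccessibleCategory κ
  have le := le_of_eq_or_isSharplyLess h
  let Y : C ⥤ D := hK.toKappaInd ⋙ e.functor
  have hY (J : Type w) [SmallCategory J] [IsCardinalFiltered J κ]
      (hJ : HasCardinalLT (Arrow J) lam) : PreservesColimitsOfShape J Y := by
    have (a : K) : PreservesColimitsOfShape J
      (coyoneda.obj (op ((IsPresentableBelow C κ lam).ι.obj a))) := a.property J hJ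
    have : PreservesColimitsOfShape J hK.toKappaInd :=
      ⟨fun {G} ↦ hK.preservesColimit_toKappaInd G⟩
    dsimp only [Y]
    infer_instance
  let R : ObjectProperty D := ((yonedaInd K κ).essImage).map e.functor
  have hR : R.IsCardinalFilteredGenerator κ := e.toAdjunction.isCardinalFilteredGenerator
    isCardinalFilteredGenerator_essImage_yonedaInd
  have hRY : R ≤ Y.essImage := by
    rintro _ ⟨_, ⟨X, ⟨e₁⟩⟩, ⟨e₂⟩⟩
    exact ⟨X.obj, ⟨e.functor.mapIso (hK.compToKappaIndIso.app X ≪≫ e₁) ≪≫ e₂⟩⟩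
  have hYR (X : K) : R (Y.obj X.obj) :=
    ⟨_, ⟨X, ⟨Iso.refl _⟩⟩, ⟨e.functor.mapIso (hK.compToKappaIndIso.symm.app X)⟩⟩
  have hlam := isCardinalFilteredGenerator_smallFilteredColimits D h hR
  -- Together, `h₁` and `h₂` say that C embeds in `D` as λ-presentable objects, among them all those
  -- of the λ-filtered generator.
  have h₁ : smallFilteredColimits R κ lam ≤ Y.essImage := by
    rintro Z ⟨J, _, _, hJ, hZ⟩
    have := hC.hasColimitsOfShape J hJ
    have := hY J hJ
    exact ObjectProperty.IsClosedUnderColimitsOfShape.colimitsOfShape_le (P := Y.essImage) (J := J)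
      _ (ObjectProperty.colimitsOfShape_monotone J hRY _ hZ)
  have h₂ (X : C) : IsCardinalPresentable (Y.obj X) lam := by
    obtain ⟨J, _, _, hJ, ⟨p⟩⟩ := hC.exists_colimit X
    have := hY J hJ
    exact hlam.le_isCardinalPresentable _ ⟨J, inferInstance, inferInstance, hJ,
      ⟨{toColimitPresentation := p.toColimitPresentation.map Y
        prop_diag_obj j := hYR ⟨_, p.prop_diag_obj j⟩ }⟩⟩
  have hYlam : IsIndDense Y lam := .mk fun Z ↦ by
    obtain ⟨J, _, _, ⟨p⟩⟩ := hlam.exists_colimitsOfShape Z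
    refine ⟨J, inferInstance, inferInstance, p.ofLE h₁, fun X ↦ ?_⟩
    have := preservesColimitsOfShape_of_isCardinalPresentable (Y.obj X) lam J
    infer_instance
  have : HasCardinalFilteredColimits.{w} D lam :=
    ⟨fun J _ _ ↦
      have := IsCardinalFiltered.of_le J le
      HasCardinalFilteredColimits.hasColimitsOfShape D κ J⟩
  obtain ⟨e'⟩ := hYlam.nonempty_equivalence h₂
  exact e'.isCardinalAccessibleCategory κ

end IsAccessiblyGenerated

end

end AccGen

theorem mainTheorem8 (κ lam : Cardinal.{w}) [Fact κ.IsRegular] [Fact lam.IsRegular]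
    (h : κ = lam ∨ AccGen.IsSharplyLess κ lam)
    (C : Type u) [Category.{w} C] [IsIdempotentComplete C] :
    List.TFAE
      [AccGen.IsAccessiblyGenerated C κ lam,
       IsCardinalAccessibleCategory (AccGen.KappaInd C lam) κ,
       ∃ (D : Type (w + 1)) (_ : Category.{w} D), IsCardinalAccessibleCategory D κ ∧
         Nonempty (C ≌ AccGen.PresentableObjects D lam)] := by
  tfae_have 1 → 2 := fun hC ↦ hC.isCardinalAccessibleCategory_kappaInd h
  tfae_have 2 → 3 := fun _ ↦ AccGen.exists_presentableObjects_equivalence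
  tfae_have 3 → 1 := by
    rintro ⟨D, _, _, ⟨e⟩⟩
    exact (AccGen.isAccessiblyGenerated_presentableObjects D h).of_equivalence e.symm
  tfae_finish
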